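/- Let $d,k,t\ge 1$ be integers and let $\mathcal H_d=\mathbb C^d$, $\mathcal H_k=\mathbb C^k$ with standard bases; $|0\rangle$ denotes the first basis vector of $\mathcal H_k$. A channel on $\mathcal H_d$ is a completely positive trace-preserving linear map $\Phi$ on the $d\times d$ complex matrices. For a linear map $\Psi$ on operators on $\mathcal H_d^{\otimes t}$ the Choi–Jamiołkowski state is $\sigma_\Psi=(\Psi\otimes\mathrm{id})(|\psi_+\rangle\langle\psi_+|)$ with $|\psi_+\rangle=d^{-t/2}\sum_{a\in\{1,\dots,d\}^t}|a\,a\rangle$; its entries are $(\sigma_\Psi)_{(i,a),(j,b)}=d^{-t}\langle i|\Psi(|a\rangle\langle b|)|j\rangle$. For a unitary $U$ on $\mathcal H_d\otimes\mathcal H_k$ put $$\Phi_{U,t}(\rho)=\operatorname{Tr}_E\!\left[U^{\otimes t}\left(\rho\otimes|0\rangle\langle 0|^{\otimes t}\right)(U^\dagger)^{\otimes t}\right],$$ where $\operatorname{Tr}_E$ is the partial trace over $\mathcal H_k^{\otimes t}$, and let $$\langle\sigma_{\Phi^{\otimes t}}\rangle_{\mathcal U(dk)}=\int_{\mathcal U(dk)}\sigma_{\Phi_{U,t}}\,dU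 ,$$ with $dU$ the Haar probability measure. A finite nonempty family $X=(\Phi_1,\dots,\Phi_m)$ of channels on $\mathcal H_d$ (repetitions allowed) is a channel $[t,k]$-design if for every operator $\rho$ on $\mathcal H_d^{\otimes t}$ $$\frac1m\sum_{i=1}^m\Phi_i^{\otimes t}(\rho)=\int_{\mathcal U(dk)}\Phi_{U,t}(\rho)\,dU .$$ For $\sigma\in S_t$ let $\operatorname{Cl}(\sigma)$ be the number of cycles of $\sigma$, fixed points included, and let $\operatorname{Wg}(\cdot,D)$ be the Weingarten function of $\mathcal U(D)$ on $S_t$: $\operatorname{Wg}(\sigma\tau^{-1},D)$ is the $(\sigma,\tau)$ entry of the Moore–Penrose inverse of the matrix $\left(D^{\operatorname{Cl}(\sigma\tau^{-1})}\right)_{\sigma,\tau\in S_t}$ (the ordinary inverse if $t\le D$). Then: 1. For all $a,b,i,j\in\{1,\dots,d\}^t$, $$\left(\langle\sigma_{\Phi^{\otimes t}}\rangle_{\mathcal U(dk)}\right)_{(i,a),(j,b)}=\frac1{d^t}\sum_{\sigma,\tau\in S_t}\operatorname{Wg}(\sigma\tau^{-1},dk)\,k^{\operatorname{Cl}(\tau)}\prod_{n=1}^t\delta_{a_n,b_{\sigma(n)}}\,\delta_{i_n,j_{\tau(n)}}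 .$$ 2. For every finite nonempty family $X=(\Phi_1,\dots,\Phi_m)$ of channels on $\mathcal H_d$ and every norm $\|\cdot\|$ on the $d^{2t}\times d^{2t}$ complex matrices, $$\left\|\frac1m\sum_{i=1}^m\sigma_{\Phi_i^{\otimes t}}-\langle\sigma_{\Phi^{\otimes t}}\rangle_{\mathcal U(dk)}\right\|\ge 0,$$ with equality if and only if $X$ is a channel $[t,k]$-design. -/

import Mathlib

open Matrix
open scoped Kronecker

namespace ChannelDesign

noncomputable section

/-! ### Haar measure on the unitary group -/

section Haar

variable (n : Type) [Fintype n] [DecidableEq n]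

instance instCompactSpaceUnitaryGroup : CompactSpace (unitaryGroup n ℂ) := by
  refine isCompact_iff_compactSpace.mp (?_ :
    IsCompact ((unitaryGroup n ℂ : Submonoid (Matrix n n ℂ)) : Set (Matrix n n ℂ)))
  have hK : IsCompact (Set.pi Set.univ fun _ : n => Set.pi Set.univ fun _ : n =>
      Metric.closedBall (0 : ℂ) 1) :=
    isCompact_univ_pi fun _ => isCompact_univ_pi fun _ => isCompact_closedBall _ _
  refine IsCompact.of_isClosed_subset (s := (Set.pi Set.univ fun _ : n =>
      Set.pi Set.univ fun _ : n => Metric.closedBall (0 : ℂ) 1 : Set (Matrix n n ℂ))) hK ?_ ?_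
  · have h : ((unitaryGroup n ℂ : Submonoid (Matrix n n ℂ)) : Set (Matrix n n ℂ)) =
        {A | A * star A = 1} := by
      ext A
      exact mem_unitaryGroup_iff
    rw [h]
    exact isClosed_eq (by fun_prop) continuous_const
  · intro U hU i _ j _
    simpa using entry_norm_bound_of_unitary hU i j

instance instMeasurableSpaceUnitaryGroup : MeasurableSpace (unitaryGroup n ℂ) := borel _

instance instBorelSpaceUnitaryGroup : BorelSpace (unitaryGroup n ℂ) := ⟨rfl⟩

/-- The Haar measure on the unitary group, normalised to total mass one. -/
def haarUnitary : MeasureTheory.Measure (unitaryGroup n ℂ) :=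
  MeasureTheory.Measure.haarMeasure ⊤

end Haar

/-! ### Quantum channels -/

open scoped MatrixOrder Matrix.Norms.L2Operator in
/-- A quantum channel on the `d`-dimensional Hilbert space: a completely positive
trace-preserving linear map on the `d × d` complex matrices (with the Loewner order). -/
structure Channel (d : ℕ) extends
    CompletelyPositiveMap (Matrix (Fin d) (Fin d) ℂ) (Matrix (Fin d) (Fin d) ℂ) where
  trace_map : ∀ ρ : Matrix (Fin d) (Fin d) ℂ, (toLinearMap ρ).trace = ρ.trace

open scoped MatrixOrder Matrix.Norms.L2Operator in
/-- The linear map on `d × d` matrices underlying a channel. -/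
def Channel.lin {d : ℕ} (Φ : Channel d) :
    Matrix (Fin d) (Fin d) ℂ →ₗ[ℂ] Matrix (Fin d) (Fin d) ℂ :=
  Φ.toCompletelyPositiveMap.toLinearMap

/-! ### Tensor powers

The `t`-fold tensor power of the space with basis `n` has the basis `Fin t → n`. -/

/-- The `t`-fold tensor (Kronecker) power of a matrix. -/
def tensorPowMatrix {n : Type} (t : ℕ) (A : Matrix n n ℂ) :
    Matrix (Fin t → n) (Fin t → n) ℂ :=
  Matrix.of fun i j => ∏ s, A (i s) (j s)

/-- The `t`-fold tensor power of a linear map `Φ` between matrices: the linear map that sends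
the matrix unit `E_{a₁b₁} ⊗ ⋯ ⊗ E_{a_tb_t}` to `Φ(E_{a₁b₁}) ⊗ ⋯ ⊗ Φ(E_{a_tb_t})`. -/
def tensorPowMap {n : Type} [Fintype n] [DecidableEq n] (t : ℕ)
    (Φ : Matrix n n ℂ →ₗ[ℂ] Matrix n n ℂ) :
    Matrix (Fin t → n) (Fin t → n) ℂ →ₗ[ℂ] Matrix (Fin t → n) (Fin t → n) ℂ where
  toFun ρ := ∑ a, ∑ b, ρ a b •
    Matrix.of fun i j => ∏ s, Φ (Matrix.single (a s) (b s) 1) (i s) (j s)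
  map_add' ρ ρ' := by
    simp only [Matrix.add_apply, add_smul, Finset.sum_add_distrib]
  map_smul' c ρ := by
    simp only [Matrix.smul_apply, smul_eq_mul, mul_smul, Finset.smul_sum, RingHom.id_apply]

/-- `Φ^{⊗t}` on products of operators; this pins `tensorPowMap` down. -/
theorem tensorPowMap_product {n : Type} [Fintype n] [DecidableEq n] (t : ℕ)
    (Φ : Matrix n n ℂ →ₗ[ℂ] Matrix n n ℂ) (A : Fin t → Matrix n n ℂ) :
    tensorPowMap t Φ (Matrix.of fun a b => ∏ s, A s (a s) (b s)) =
      Matrix.of fun i j => ∏ s, Φ (A s) (i s) (j s) := by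
  ext i j
  have h : ∀ s, Φ (A s) (i s) (j s) =
      ∑ p : n × n, A s p.1 p.2 * Φ (Matrix.single p.1 p.2 1) (i s) (j s) := by
    intro s
    conv_lhs => rw [Matrix.matrix_eq_sum_single (A s)]
    simp only [map_sum, Fintype.sum_prod_type, Matrix.sum_apply]
    refine Finset.sum_congr rfl fun x _ => Finset.sum_congr rfl fun y _ => ?_
    rw [show Matrix.single x y (A s x y) = A s x y • Matrix.single x y (1 : ℂ) by simp,
      map_smul, Matrix.smul_apply, smul_eq_mul]
  simp only [Matrix.of_apply, h, Finset.prod_univ_sum, Fintype.piFinset_univ]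
  rw [← (Equiv.arrowProdEquivProdArrow (Fin t) (fun _ => n) (fun _ => n)).symm.sum_comp]
  simp [tensorPowMap, Fintype.sum_prod_type, Matrix.sum_apply, Finset.prod_mul_distrib,
    Equiv.arrowProdEquivProdArrow]

/-! ### Choi–Jamiołkowski states -/

/-- The maximally entangled unit vector `(1/√|n|) ∑ₐ |a a⟩` of two copies of the space with
basis `n`. -/
def maxEntangled (n : Type) [Fintype n] [DecidableEq n] : n × n → ℂ :=
  fun p => if p.1 = p.2 then ((Real.sqrt (Fintype.card n) : ℝ) : ℂ)⁻¹ else 0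

/-- The extension `Ψ ⊗ id` of a linear map on operators by an ancilla with basis `m`: it
applies `Ψ` to every block `(X_{(i,p),(j,q)})_{i,j}`. -/
def extendMap {n : Type} (m : Type) (Ψ : Matrix n n ℂ →ₗ[ℂ] Matrix n n ℂ)
    (X : Matrix (n × m) (n × m) ℂ) : Matrix (n × m) (n × m) ℂ :=
  Matrix.of fun x y => Ψ (Matrix.of fun i j => X (i, x.2) (j, y.2)) x.1 y.1

/-- The Choi–Jamiołkowski state `σ_Ψ = (Ψ ⊗ id)(|ψ₊⟩⟨ψ₊|)`. -/
def choi {n : Type} [Fintype n] [DecidableEq n] (Ψ : Matrix n n ℂ →ₗ[ℂ] Matrix n n ℂ) :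
    Matrix (n × n) (n × n) ℂ :=
  extendMap n Ψ (Matrix.vecMulVec (maxEntangled n) (star (maxEntangled n)))

/-! ### Random channels from Haar-random unitaries on system and environment -/

/-- The partial trace over the second factor (the environment). -/
def traceEnv {n e : Type} [Fintype e] (M : Matrix (n × e) (n × e) ℂ) : Matrix n n ℂ :=
  Matrix.of fun i j => ∑ l, M (i, l) (j, l)

/-- `U^{⊗t}` for a matrix `U` on `H_d ⊗ H_k`, viewed on `H_d^{⊗t} ⊗ H_k^{⊗t}`. -/
def tensorPowSplit {d k : ℕ} (t : ℕ) (U : Matrix (Fin d × Fin k) (Fin d × Fin k) ℂ) :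
    Matrix ((Fin t → Fin d) × (Fin t → Fin k)) ((Fin t → Fin d) × (Fin t → Fin k)) ℂ :=
  (tensorPowMatrix t U).reindex
    (Equiv.arrowProdEquivProdArrow (Fin t) (fun _ => Fin d) (fun _ => Fin k))
    (Equiv.arrowProdEquivProdArrow (Fin t) (fun _ => Fin d) (fun _ => Fin k))

/-- The map `ρ ↦ Tr_E[U^{⊗t} (ρ ⊗ |0⟩⟨0|^{⊗t}) (U†)^{⊗t}]`, where the environment consists of
`t` systems of dimension `k`, each initialised in the pure state `|0⟩`. -/
def dilation {d k : ℕ} [NeZero k] (t : ℕ) (U : Matrix (Fin d × Fin k) (Fin d × Fin k) ℂ) :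
    Matrix (Fin t → Fin d) (Fin t → Fin d) ℂ →ₗ[ℂ]
      Matrix (Fin t → Fin d) (Fin t → Fin d) ℂ where
  toFun ρ := traceEnv (tensorPowSplit t U *
    (ρ ⊗ₖ tensorPowMatrix t (Matrix.single (0 : Fin k) 0 1)) * tensorPowSplit t Uᴴ)
  map_add' ρ ρ' := by
    ext i j
    simp [traceEnv, Matrix.add_kronecker, Matrix.mul_add, Matrix.add_mul, Finset.sum_add_distrib]
  map_smul' c ρ := by
    ext i j
    simp [traceEnv, Matrix.smul_kronecker, Finset.mul_sum]

/-- The Haar average over `U(dk)` of the `t`-copy Choi–Jamiołkowski state (entrywise integral). -/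
def haarChoi (d k t : ℕ) [NeZero k] :
    Matrix ((Fin t → Fin d) × (Fin t → Fin d)) ((Fin t → Fin d) × (Fin t → Fin d)) ℂ :=
  Matrix.of fun x y => ∫ U : unitaryGroup (Fin d × Fin k) ℂ,
    choi (dilation t (U : Matrix (Fin d × Fin k) (Fin d × Fin k) ℂ)) x y
      ∂(haarUnitary (Fin d × Fin k))

/-- The average `(1/m) ∑ᵢ σ_{Φᵢ^{⊗t}}` of the `t`-copy Choi–Jamiołkowski states of a family of
channels. -/
def averageChoi {d m : ℕ} (t : ℕ) (Φ : Fin m → Channel d) :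
    Matrix ((Fin t → Fin d) × (Fin t → Fin d)) ((Fin t → Fin d) × (Fin t → Fin d)) ℂ :=
  (m : ℂ)⁻¹ • ∑ i, choi (tensorPowMap t (Φ i).lin)

/-- The family `Φ₁, …, Φ_m` is a channel `[t,k]`-design: on every operator `ρ` on `H_d^{⊗t}` the
average of `Φᵢ^{⊗t}(ρ)` equals the (entrywise) Haar average of
`Tr_E[U^{⊗t} (ρ ⊗ |0⟩⟨0|^{⊗t}) (U†)^{⊗t}]` over `U(dk)`. -/
def IsChannelDesign {d m : ℕ} (t k : ℕ) [NeZero k] (Φ : Fin m → Channel d) : Prop :=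
  ∀ ρ : Matrix (Fin t → Fin d) (Fin t → Fin d) ℂ,
    (m : ℂ)⁻¹ • ∑ i, tensorPowMap t (Φ i).lin ρ =
      Matrix.of fun x y => ∫ U : unitaryGroup (Fin d × Fin k) ℂ,
        dilation t (U : Matrix (Fin d × Fin k) (Fin d × Fin k) ℂ) ρ x y
          ∂(haarUnitary (Fin d × Fin k))

/-! ### Weingarten functions -/

/-- The number of cycles of a permutation, fixed points included. -/
def numCycles {t : ℕ} (σ : Equiv.Perm (Fin t)) : ℕ := Multiset.card σ.partition.parts

/-- The Gram matrix `(D ^ #cycles(στ⁻¹))_{σ,τ}` of the permutation operators on `(ℂ^D)^{⊗t}`. -/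
def permGram (t D : ℕ) : Matrix (Equiv.Perm (Fin t)) (Equiv.Perm (Fin t)) ℝ :=
  Matrix.of fun σ τ => (D : ℝ) ^ numCycles (σ * τ⁻¹)

/-- The Gram matrix is symmetric, so that the functional calculus below is the genuine one. -/
theorem permGram_isSelfAdjoint (t D : ℕ) : IsSelfAdjoint (permGram t D) := by
  ext σ τ
  have h : numCycles (τ * σ⁻¹) = numCycles (σ * τ⁻¹) := by
    have e : τ * σ⁻¹ = (σ * τ⁻¹)⁻¹ := by group
    rw [e]
    simp only [numCycles, Equiv.Perm.partition, Equiv.Perm.cycleType_inv,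
      Equiv.Perm.support_inv]
  simp [permGram, Matrix.star_apply, h]

/-- The Moore–Penrose inverse of the Gram matrix: the same eigenvectors, with every nonzero
eigenvalue inverted and the eigenvalue zero kept (`0⁻¹ = 0`). -/
def weingartenMatrix (t D : ℕ) : Matrix (Equiv.Perm (Fin t)) (Equiv.Perm (Fin t)) ℝ :=
  cfc (fun x : ℝ => x⁻¹) (permGram t D)

/-- The Weingarten function `Wg(σ, D)` of the unitary group `U(D)`: the pseudo-inverse of
`σ ↦ D ^ #cycles(σ)` for the convolution on the symmetric group (the inverse if `t ≤ D`). -/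
def weingarten {t : ℕ} (σ : Equiv.Perm (Fin t)) (D : ℕ) : ℝ := weingartenMatrix t D σ 1

end

end ChannelDesign

namespace ChannelDesign

/-! Part 1 is the Weingarten calculus. By invariance of the Haar measure, the matrix of moments of
`U` with prescribed columns commutes with `U^{⊗t}` for every unitary `U`. Schur–Weyl duality
(`mem_span_permMatrixHom_of_commute`) then makes it a combination of permutations of the tensor
factors. Its overlaps with these permutations are Kronecker deltas, because the columns of a unitary
matrix are orthonormal. The overlaps of the permutations with each other form the Gram matrix, so
its pseudo-inverse recovers the moment matrix (`haarMoment_apply`). An entry of the averaged Choi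
state is a sum of such moments over environment indices `l`; the condition `l = l ∘ τ` leaves `k ^
numCycles τ` of them.

Schur–Weyl duality comes from a double commutant theorem for finite groups, proved by Maschke
averaging, together with the fact that whatever commutes with all `U^{⊗t}` commutes with everything
invariant under permutation of the factors. The passage goes from unitary to diagonal to Hermitian
matrices, and by polarization to all symmetrised products.

Part 2 holds because the Choi map is linear and injective: a norm of the difference vanishes exactly
when the two averaged linear maps agree, which is the design condition. -/

/-! ### Cycles of a permutation and the functions it fixes -/

theorem numCycles_eq_card_quotient {t : ℕ} (g : Equiv.Perm (Fin t)) :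
    numCycles g = Nat.card (Quotient (Equiv.Perm.SameCycle.setoid g)) := by
  classical
  -- A point is labelled by its nontrivial cycle, or by itself if it is fixed. The fibres are the
  -- cycles, and the range has one label for each part of `g.partition`.
  let f : Fin t → Equiv.Perm (Fin t) ⊕ Fin t := fun x =>
    if g x = x then Sum.inr x else Sum.inl (g.cycleOf x)
  have hf : ∀ x y, f x = f y ↔ g.SameCycle x y := by
    intro x y
    by_cases hx : g x = x
    · have hsame : g.SameCycle x y ↔ x = y := by
        refine ⟨fun h => h.eq_of_left hx, fun h => h ▸ Equiv.Perm.SameCycle.refl _ _⟩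
      rw [hsame]
      by_cases hy : g y = y
      · simp [f, hx, hy]
      · simp only [f, hx, hy, if_true, if_false, reduceCtorEq, false_iff]
        rintro rfl
        exact hy hx
    · by_cases hy : g y = y
      · simp only [f, hx, hy, if_true, if_false, reduceCtorEq, false_iff]
        intro h
        have := h.eq_of_right hy
        subst this
        exact hx hy
      · simp only [f, hx, hy, if_false, Sum.inl.injEq]
        exact (Equiv.Perm.sameCycle_iff_cycleOf_eq_of_mem_support
          (Equiv.Perm.mem_support.2 hx) (Equiv.Perm.mem_support.2 hy)).symm
  have himg : Set.range f = ↑(g.cycleFactorsFinset.disjSum g.supportᶜ) := by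
    ext z
    simp only [Set.mem_range, Finset.mem_coe, Finset.mem_disjSum, Finset.mem_compl,
      Equiv.Perm.mem_support, not_not]
    constructor
    · rintro ⟨x, rfl⟩
      by_cases hx : g x = x
      · exact Or.inr ⟨x, hx, by simp [f, hx]⟩
      · refine Or.inl ⟨g.cycleOf x, ?_, by simp [f, hx]⟩
        exact Equiv.Perm.cycleOf_mem_cycleFactorsFinset_iff.2 (Equiv.Perm.mem_support.2 hx)
    · rintro (⟨c, hc, rfl⟩ | ⟨x, hx, rfl⟩)
      · obtain ⟨x, hx⟩ := (Equiv.Perm.mem_cycleFactorsFinset_iff.1 hc).1.nonempty_support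
        have hgx := Equiv.Perm.mem_support.1 (Equiv.Perm.mem_cycleFactorsFinset_support_le hc hx)
        refine ⟨x, ?_⟩
        simp only [f, hgx, if_false, Sum.inl.injEq]
        exact (Equiv.Perm.cycle_is_cycleOf hx hc).symm
      · exact ⟨x, by simp [f, hx]⟩
  have e : Quotient (Equiv.Perm.SameCycle.setoid g) ≃ Set.range f := by
    have : Equiv.Perm.SameCycle.setoid g = Setoid.ker f := by
      ext x y
      exact (hf x y).symm
    rw [this]
    exact Setoid.quotientKerEquivRange f
  rw [Nat.card_congr e, himg, numCycles, Equiv.Perm.parts_partition]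
  simp [Finset.card_disjSum, Equiv.Perm.cycleType_def, Finset.card_compl]

/-- A function is constant on the cycles of `g` exactly if it is fixed by `g`. -/
theorem card_comp_eq_self {n : Type} [Fintype n] [DecidableEq n] {t : ℕ}
    (g : Equiv.Perm (Fin t)) :
    Fintype.card {y : Fin t → n // y ∘ g = y} = Fintype.card n ^ numCycles g := by
  classical
  have hz : ∀ (y : Fin t → n), y ∘ g = y → ∀ (k : ℤ) x, y ((g ^ k) x) = y x := by
    intro y hy k
    have h1 : ∀ x, y (g x) = y x := fun x => congrFun hy x
    have h2 : ∀ x, y (g⁻¹ x) = y x := fun x => by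
      rw [← h1 (g⁻¹ x), ← Equiv.Perm.mul_apply, mul_inv_cancel, Equiv.Perm.one_apply]
    induction k with
    | zero => simp
    | succ m ih => intro x; rw [_root_.zpow_add_one, Equiv.Perm.mul_apply, ih, h1]
    | pred m ih => intro x; rw [_root_.zpow_sub_one, Equiv.Perm.mul_apply, ih, h2]
  let e : {y : Fin t → n // y ∘ g = y} ≃ (Quotient (Equiv.Perm.SameCycle.setoid g) → n) :=
    { toFun := fun y => Quotient.lift y.1 (by
        rintro a b ⟨k, rfl⟩
        exact (hz y.1 y.2 k a).symm)
      invFun := fun z => ⟨fun x => z (Quotient.mk _ x), by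
        funext x
        refine congrArg z (Quotient.sound ?_)
        exact Equiv.Perm.sameCycle_apply_left.2 (Equiv.Perm.SameCycle.refl _ _)⟩
      left_inv := fun y => rfl
      right_inv := fun z => by
        funext q
        induction q using Quotient.inductionOn
        rfl }
  rw [Fintype.card_congr e, Fintype.card_fun, numCycles_eq_card_quotient, Nat.card_eq_fintype_card]

/-! ### Polarization -/

/-- The polarization identity: a permanent as a signed sum of products of subset sums. -/
theorem polarization {R : Type*} [CommRing R] {t : ℕ} (f : Fin t → Fin t → R) :
    ∑ ε : Fin t → Fin 2, (∏ s, if ε s = 0 then (-1 : R) else 1) *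
      ∏ n, ∑ s, ((ε s : ℕ) : R) * f s n = ∑ π : Equiv.Perm (Fin t), ∏ s, f s (π s) := by
  classical
  -- Expanding the product over `n` gives a sum over maps `φ`. The sum over `ε` then factors over
  -- `s`, with factor `-0 ^ c + 1` where `c` is the size of the fibre of `φ` over `s`. Since `0 ^ 0
  -- = 1`, an empty fibre kills the term, so only bijections survive.
  have hinner : ∀ φ : Fin t → Fin t,
      ∑ ε : Fin t → Fin 2, (∏ s, if ε s = 0 then (-1 : R) else 1) * ∏ n, ((ε (φ n) : ℕ) : R) =
        if Function.Bijective φ then 1 else 0 := by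
    intro φ
    have h1 : ∀ ε : Fin t → Fin 2, ∏ n, ((ε (φ n) : ℕ) : R) =
        ∏ s, ((ε s : ℕ) : R) ^ (Finset.univ.filter fun n => φ n = s).card := by
      intro ε
      rw [← Finset.prod_fiberwise' Finset.univ φ fun s => ((ε s : ℕ) : R)]
      simp
    simp_rw [h1, ← Finset.prod_mul_distrib]
    rw [← Fintype.prod_sum (fun s (e : Fin 2) => (if e = 0 then (-1 : R) else 1) *
      ((e : ℕ) : R) ^ (Finset.univ.filter fun n => φ n = s).card)]
    simp only [Fin.sum_univ_two]
    by_cases h : Function.Bijective φ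
    · rw [if_pos h]
      refine Finset.prod_eq_one fun s _ => ?_
      obtain ⟨n, hn⟩ := h.2 s
      have : (Finset.univ.filter fun n => φ n = s).card ≠ 0 :=
        Finset.card_ne_zero.2 ⟨n, by simpa using hn⟩
      simp [this]
    · rw [if_neg h]
      have : ¬ Function.Surjective φ := fun hs => h (Finite.surjective_iff_bijective.1 hs)
      simp only [Function.Surjective, not_forall, not_exists] at this
      obtain ⟨s, hs⟩ := this
      refine Finset.prod_eq_zero (Finset.mem_univ s) ?_
      simp [hs]
  simp_rw [Fintype.prod_sum, Finset.mul_sum, Finset.prod_mul_distrib, ← mul_assoc]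
  rw [Finset.sum_comm]
  simp_rw [← Finset.sum_mul, hinner, ite_mul, one_mul, zero_mul]
  rw [← Finset.sum_filter]
  refine (Finset.sum_bij (fun (π : Equiv.Perm (Fin t)) _ => ⇑π⁻¹) ?_ ?_ ?_ ?_).symm
  · intro π _
    exact Finset.mem_filter.2 ⟨Finset.mem_univ _, (π⁻¹).bijective⟩
  · intro π _ π' _ h
    exact inv_injective (DFunLike.coe_injective h)
  · intro φ hφ
    refine ⟨(Equiv.ofBijective φ (Finset.mem_filter.1 hφ).2)⁻¹, Finset.mem_univ _, ?_⟩
    rw [inv_inv]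
    rfl
  · intro π _
    rw [← Equiv.prod_comp π⁻¹ fun s => f s (π s)]
    simp

/-! ### The double commutant of a finite matrix group -/

/-- The double commutant theorem for a finite group of matrices. -/
theorem mem_span_of_commute_commutant {G W : Type*} [Group G] [Fintype G] [Fintype W]
    [DecidableEq W] (P : G →* Matrix W W ℂ) (T : Matrix W W ℂ)
    (hT : ∀ C, (∀ g, Commute (P g) C) → Commute T C) :
    T ∈ Submodule.span ℂ (Set.range P) := by
  set A := Submodule.span ℂ (Set.range P) with hA
  have hPA : ∀ g, ∀ X ∈ A, P g * X ∈ A := by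
    intro g X hX
    induction hX using Submodule.span_induction with
    | mem X hX =>
      obtain ⟨h, rfl⟩ := hX
      rw [← map_mul]
      exact Submodule.subset_span ⟨_, rfl⟩
    | zero => simp
    | add X Y _ _ hX hY => rw [mul_add]; exact A.add_mem hX hY
    | smul c X _ hX => rw [mul_smul_comm]; exact A.smul_mem _ hX
  -- Maschke's argument: a linear projection `p₀` onto `A`, averaged over the group, becomes a
  -- projection `p` onto `A` that commutes with left multiplication by every `P g`.
  obtain ⟨p₀, hp₀⟩ := A.subtype.exists_leftInverse_of_injective (by simp)
  have hp₀' : ∀ X (hX : X ∈ A), (p₀ X : Matrix W W ℂ) = X := fun X hX =>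
    congrArg Subtype.val (LinearMap.congr_fun hp₀ ⟨X, hX⟩)
  let p : Matrix W W ℂ →ₗ[ℂ] Matrix W W ℂ := (Fintype.card G : ℂ)⁻¹ • ∑ g : G,
    (LinearMap.mulLeft ℂ (P g)) ∘ₗ A.subtype ∘ₗ p₀ ∘ₗ (LinearMap.mulLeft ℂ (P g⁻¹))
  have hp : ∀ X, p X = (Fintype.card G : ℂ)⁻¹ • ∑ g : G, P g * (p₀ (P g⁻¹ * X)) := by
    intro X
    simp [p]
  have hpmem : ∀ X, p X ∈ A := fun X => by
    rw [hp]
    exact A.smul_mem _ (A.sum_mem fun g _ => hPA g _ (p₀ _).2)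
  have hpid : p 1 = 1 := by
    have h1 : (1 : Matrix W W ℂ) ∈ A := Submodule.subset_span ⟨1, map_one P⟩
    rw [hp]
    have : ∀ g, P g * (p₀ (P g⁻¹ * 1) : Matrix W W ℂ) = 1 := fun g => by
      rw [hp₀' _ (hPA _ _ h1), ← mul_assoc, ← map_mul]
      simp
    simp only [this, Finset.sum_const, Finset.card_univ]
    rw [← Nat.cast_smul_eq_nsmul ℂ, smul_smul, inv_mul_cancel₀ (by simp), one_smul]
  have hpeq : ∀ g X, p (P g * X) = P g * p X := by
    intro g X
    rw [hp, hp, mul_smul_comm, Finset.mul_sum]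
    congr 1
    rw [← Equiv.sum_comp (Equiv.mulLeft g)]
    refine Finset.sum_congr rfl fun h _ => ?_
    simp only [Equiv.coe_mulLeft, map_mul, mul_assoc]
    rw [← mul_assoc (P (g * h)⁻¹), ← map_mul, _root_.mul_inv_rev, inv_mul_cancel_right]
  -- Equivariance of `p` says that each block of its coefficients, with `s` and `v` fixed, lies in
  -- the commutant. Hence `p` also commutes with left multiplication by `T`, and `T = T * p 1 = p T`
  -- lies in `A`.
  have hC : ∀ s v, Commute T (Matrix.of fun r u => p (single u v 1) r s) := by
    refine fun s v => hT _ fun g => ?_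
    ext r u
    have h1 : P g * single u v 1 = ∑ w, P g w u • single w v (1 : ℂ) := by
      ext a b
      simp only [Matrix.mul_apply, Matrix.sum_apply, Matrix.smul_apply, single_apply]
      by_cases hb : v = b <;> simp [hb]
    have h2 := congrFun (congrFun (hpeq g (single u v 1)) r) s
    rw [h1, map_sum, Matrix.sum_apply, Matrix.mul_apply] at h2
    simp only [Matrix.mul_apply, of_apply]
    rw [← h2]
    exact Finset.sum_congr rfl fun w _ => by
      rw [map_smul, Matrix.smul_apply, smul_eq_mul, mul_comm]
  have key : T = p T := by
    ext r s
    have h1 : T r s = ∑ v, (T * Matrix.of fun r u => p (single u v 1) r s) r v := by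
      conv_lhs => rw [← mul_one T, ← hpid, ← sum_single_one, map_sum, Finset.mul_sum,
        Matrix.sum_apply]
      rfl
    have h2 : T = ∑ u, ∑ v, T u v • single u v (1 : ℂ) := by
      conv_lhs => rw [Matrix.matrix_eq_sum_single T]
      simp
    rw [h1]
    simp_rw [fun v => (hC s v).eq]
    conv_rhs => rw [h2]
    simp only [map_sum, map_smul, Matrix.sum_apply, Matrix.mul_apply, of_apply, Matrix.smul_apply,
      smul_eq_mul]
    rw [Finset.sum_comm]
    simp [mul_comm]
  rw [key]
  exact hpmem T

/-! ### Tensor powers and Schur–Weyl duality -/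

theorem tensorPowMatrix_apply {n : Type} {t : ℕ} (A : Matrix n n ℂ) (x y : Fin t → n) :
    tensorPowMatrix t A x y = ∏ s, A (x s) (y s) := rfl

theorem tensorPowMatrix_mul {n : Type} [Fintype n] {t : ℕ} (A B : Matrix n n ℂ) :
    tensorPowMatrix t (A * B) = tensorPowMatrix t A * tensorPowMatrix t B := by
  classical
  ext x y
  simp [Matrix.mul_apply, tensorPowMatrix_apply, Fintype.prod_sum, Finset.prod_mul_distrib]

theorem tensorPowMatrix_one {n : Type} [DecidableEq n] {t : ℕ} :
    tensorPowMatrix t (1 : Matrix n n ℂ) = 1 := by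
  ext x y
  simp only [tensorPowMatrix_apply, Matrix.one_apply, Finset.prod_ite_zero, Finset.mem_univ,
    true_implies, Finset.prod_const_one, funext_iff]

/-- The unitary representation of the symmetric group permuting the tensor factors. -/
def permMatrixHom (n : Type) [Fintype n] [DecidableEq n] (t : ℕ) :
    Equiv.Perm (Fin t) →* Matrix (Fin t → n) (Fin t → n) ℂ where
  toFun σ := Matrix.of fun x y => if x ∘ σ = y then 1 else 0
  map_one' := by
    ext x y
    simp [Matrix.one_apply]
  map_mul' σ τ := by
    ext x y
    simp only [Matrix.mul_apply, of_apply, ite_mul, one_mul, zero_mul, Finset.sum_ite_eq,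
      Finset.mem_univ, if_true]
    rfl

theorem permMatrixHom_apply {n : Type} [Fintype n] [DecidableEq n] {t : ℕ}
    (σ : Equiv.Perm (Fin t)) (x y : Fin t → n) :
    permMatrixHom n t σ x y = if x ∘ σ = y then 1 else 0 := rfl

theorem commute_permMatrixHom_iff {n : Type} [Fintype n] [DecidableEq n] {t : ℕ}
    (σ : Equiv.Perm (Fin t)) (C : Matrix (Fin t → n) (Fin t → n) ℂ) :
    Commute (permMatrixHom n t σ) C ↔ ∀ x y, C (x ∘ σ) (y ∘ σ) = C x y := by
  have h2 : ∀ z y : Fin t → n, z ∘ σ = y ↔ z = y ∘ ⇑σ⁻¹ := by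
    refine fun z y => ⟨?_, ?_⟩ <;> rintro rfl <;> ext <;> simp
  have h1 : ∀ x y, (permMatrixHom n t σ * C) x y = C (x ∘ σ) y := by
    simp [Matrix.mul_apply, permMatrixHom_apply]
  have h3 : ∀ x y, (C * permMatrixHom n t σ) x y = C x (y ∘ ⇑σ⁻¹) := by
    simp [Matrix.mul_apply, permMatrixHom_apply, h2]
  constructor
  · intro h x y
    rw [← h1, h.eq, h3]
    congr 1
    ext
    simp
  · intro h
    ext x y
    rw [h1, h3, ← h x (y ∘ ⇑σ⁻¹)]
    congr 1
    ext
    simp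

/-- Diagonal unitaries already force `T x y = 0` unless `x` and `y` contain each basis index equally
often, and then every diagonal tensor power takes the same value at `x` and at `y`. -/
theorem commute_tensorPow_diagonal {n : Type} [Fintype n] [DecidableEq n] {t : ℕ}
    {T : Matrix (Fin t → n) (Fin t → n) ℂ}
    (hT : ∀ U ∈ unitaryGroup n ℂ, Commute T (tensorPowMatrix t U)) (z : n → ℂ) :
    Commute T (tensorPowMatrix t (diagonal z)) := by
  have hdiag : ∀ z : n → ℂ, tensorPowMatrix t (diagonal z) =
      diagonal fun x : Fin t → n => ∏ s, z (x s) := by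
    intro z
    ext x y
    simp only [tensorPowMatrix_apply, diagonal_apply, Finset.prod_ite_zero, Finset.mem_univ,
      true_implies, funext_iff]
  have hcomm : ∀ z : n → ℂ, Commute T (tensorPowMatrix t (diagonal z)) ↔
      ∀ x y, T x y ≠ 0 → ∏ s, z (x s) = ∏ s, z (y s) := by
    intro z
    rw [hdiag, commute_iff_eq, ← Matrix.ext_iff]
    refine forall_congr' fun x => forall_congr' fun y => ?_
    rw [Matrix.mul_diagonal, Matrix.diagonal_mul, mul_comm]
    refine ⟨fun h h0 => (mul_right_cancel₀ h0 h).symm, fun h => ?_⟩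
    by_cases h0 : T x y = 0
    · simp [h0]
    · rw [h h0]
  have hprod : ∀ (z : n → ℂ) (x : Fin t → n),
      ∏ s, z (x s) = ∏ c, z c ^ (Finset.univ.filter fun s => x s = c).card := by
    intro z x
    rw [← Finset.prod_fiberwise' Finset.univ x z]
    simp
  rw [hcomm]
  intro x y hxy
  have hcard : ∀ c, (Finset.univ.filter fun s => x s = c).card =
      (Finset.univ.filter fun s => y s = c).card := by
    intro c
    -- Multiplicities lie between `0` and `t`, so powers of a root of unity of order `t + 1` tell
    -- them apart.
    obtain ⟨w, hw⟩ : ∃ w : ℂ, IsPrimitiveRoot w (t + 1) :=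
      ⟨_, Complex.isPrimitiveRoot_exp (t + 1) (by omega)⟩
    have hw1 : ‖w‖ = 1 := hw.norm'_eq_one (by omega)
    have hU : diagonal (Function.update (1 : n → ℂ) c w) ∈ unitaryGroup n ℂ := by
      rw [mem_unitaryGroup_iff, star_eq_conjTranspose, diagonal_conjTranspose,
        diagonal_mul_diagonal, ← diagonal_one]
      congr 1
      funext b
      by_cases hb : b = c
      · subst hb
        simp [Complex.mul_conj, Complex.normSq_eq_norm_sq, hw1]
      · simp [hb]
    have h := (hcomm _).1 (hT _ hU) x y hxy
    rw [hprod, hprod] at h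
    have hpow : ∀ m : n → ℕ, ∏ b, Function.update (1 : n → ℂ) c w b ^ m b = w ^ m c := by
      intro m
      rw [Finset.prod_eq_single c]
      · simp
      · intro b _ hb
        simp [hb]
      · simp
    rw [hpow, hpow] at h
    have hle : ∀ x : Fin t → n, (Finset.univ.filter fun s => x s = c).card < t + 1 := fun x =>
      Nat.lt_succ_of_le ((Finset.card_le_univ _).trans (by simp))
    exact hw.pow_inj (hle x) (hle y) h
  rw [hprod, hprod]
  simp_rw [hcard]

theorem commute_tensorPow_isHermitian {n : Type} [Fintype n] [DecidableEq n] {t : ℕ}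
    {T : Matrix (Fin t → n) (Fin t → n) ℂ}
    (hT : ∀ U ∈ unitaryGroup n ℂ, Commute T (tensorPowMatrix t U))
    {H : Matrix n n ℂ} (hH : H.IsHermitian) : Commute T (tensorPowMatrix t H) := by
  have h := hH.spectral_theorem
  rw [Unitary.conjStarAlgAut_apply] at h
  rw [h, tensorPowMatrix_mul, tensorPowMatrix_mul]
  exact ((hT _ hH.eigenvectorUnitary.2).mul_right (commute_tensorPow_diagonal hT _)).mul_right
    (hT _ (star hH.eigenvectorUnitary).2)

/-- The symmetrised tensor product of a family of matrices. -/
def symTensor {n : Type} {t : ℕ} (A : Fin t → Matrix n n ℂ) :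
    Matrix (Fin t → n) (Fin t → n) ℂ :=
  Matrix.of fun x y => ∑ π : Equiv.Perm (Fin t), ∏ s, A s (x (π s)) (y (π s))

/-- For Hermitian factors, polarization writes the symmetrised product through tensor powers of
subset sums, which are again Hermitian. The general case follows by multilinearity from `B = H + iK`
with `H` and `K` Hermitian. -/
theorem commute_symTensor {n : Type} [Fintype n] [DecidableEq n] {t : ℕ}
    {T : Matrix (Fin t → n) (Fin t → n) ℂ}
    (hT : ∀ U ∈ unitaryGroup n ℂ, Commute T (tensorPowMatrix t U))
    (A : Fin t → Matrix n n ℂ) : Commute T (symTensor A) := by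
  have herm : ∀ H : Fin t → Matrix n n ℂ, (∀ s, (H s).IsHermitian) → Commute T (symTensor H) := by
    intro H hH
    have h : symTensor H = ∑ ε : Fin t → Fin 2, (∏ s, if ε s = 0 then (-1 : ℂ) else 1) •
        tensorPowMatrix t (∑ s, ((ε s : ℕ) : ℂ) • H s) := by
      ext x y
      simp only [symTensor, of_apply, Matrix.sum_apply, Matrix.smul_apply, smul_eq_mul,
        tensorPowMatrix_apply]
      exact (polarization fun s m => H s (x m) (y m)).symm
    rw [h]
    refine Commute.sum_right _ _ _ fun ε _ => (commute_tensorPow_isHermitian hT ?_).smul_right _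
    rw [IsHermitian, conjTranspose_sum]
    refine Finset.sum_congr rfl fun s _ => ?_
    rw [conjTranspose_smul, (hH s).eq]
    simp
  have hdec : ∀ B : Matrix n n ℂ, ∃ K : Fin 2 → Matrix n n ℂ, (∀ e, (K e).IsHermitian) ∧
      B = ∑ e : Fin 2, Complex.I ^ (e : ℕ) • K e := by
    intro B
    refine ⟨![(realPart B : Matrix n n ℂ), (imaginaryPart B : Matrix n n ℂ)], ?_, ?_⟩
    · intro e
      fin_cases e
      · exact (realPart B).2
      · exact (imaginaryPart B).2
    · simpa [Fin.sum_univ_two] using (realPart_add_I_smul_imaginaryPart B).symm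
  choose K hK hAK using fun s => hdec (A s)
  have h : symTensor A = ∑ ψ : Fin t → Fin 2, (∏ s, Complex.I ^ (ψ s : ℕ)) •
      symTensor fun s => K s (ψ s) := by
    ext x y
    simp only [symTensor, of_apply, Matrix.sum_apply, Matrix.smul_apply, smul_eq_mul]
    simp_rw [Finset.mul_sum]
    rw [Finset.sum_comm]
    refine Finset.sum_congr rfl fun π _ => ?_
    simp_rw [← Finset.prod_mul_distrib]
    rw [← Fintype.prod_sum fun s (e : Fin 2) => Complex.I ^ (e : ℕ) * K s e (x (π s)) (y (π s))]
    refine Finset.prod_congr rfl fun s _ => ?_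
    conv_lhs => rw [hAK s]
    simp [Matrix.sum_apply]
  rw [h]
  exact Commute.sum_right _ _ _ fun ψ _ => (herm _ fun s => hK s _).smul_right _

/-- Schur–Weyl duality: the commutant of the tensor powers of the unitaries is spanned by the
permutations of the tensor factors. -/
theorem mem_span_permMatrixHom_of_commute {n : Type} [Fintype n] [DecidableEq n] {t : ℕ}
    {T : Matrix (Fin t → n) (Fin t → n) ℂ}
    (hT : ∀ U ∈ unitaryGroup n ℂ, Commute T (tensorPowMatrix t U)) :
    T ∈ Submodule.span ℂ (Set.range (permMatrixHom n t)) := by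
  refine mem_span_of_commute_commutant _ T fun C hC => ?_
  have hinv : ∀ (σ : Equiv.Perm (Fin t)) x y, C (x ∘ σ) (y ∘ σ) = C x y := fun σ =>
    (commute_permMatrixHom_iff σ C).1 (hC σ)
  -- Invariance of `C` under simultaneous permutation of rows and columns makes it equal to its own
  -- symmetrisation, which is a combination of symmetrised products of matrix units.
  have h : C = (t.factorial : ℂ)⁻¹ • ∑ r, ∑ s, C r s •
      symTensor fun m => single (r m) (s m) (1 : ℂ) := by
    have h1 : ∑ r, ∑ s, C r s • symTensor (fun m => single (r m) (s m) (1 : ℂ)) =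
        (t.factorial : ℂ) • C := by
      ext x y
      simp only [symTensor, Matrix.sum_apply, Matrix.smul_apply, of_apply, smul_eq_mul,
        single_apply, Finset.prod_ite_zero, Finset.mem_univ, true_implies, Finset.prod_const_one]
      have h2 : ∀ (r s : Fin t → n) (π : Equiv.Perm (Fin t)),
          (∀ m, r m = x (π m) ∧ s m = y (π m)) ↔ (r = x ∘ π ∧ s = y ∘ π) := by
        intro r s π
        simp only [funext_iff, Function.comp_apply, forall_and]
      simp_rw [h2, Finset.mul_sum]
      rw [Finset.sum_congr rfl fun r _ => Finset.sum_comm, Finset.sum_comm]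
      simp [ite_and, hinv, Finset.card_univ, Fintype.card_perm]
    rw [h1, smul_smul, inv_mul_cancel₀ (by exact_mod_cast t.factorial_ne_zero), one_smul]
  rw [h]
  exact (Commute.sum_right _ _ _ fun r _ => Commute.sum_right _ _ _ fun s _ =>
    (commute_symTensor hT _).smul_right _).smul_right _

/-! ### The pseudo-inverse of the Gram matrix -/

theorem permGram_mul_right {t D : ℕ} (σ τ g : Equiv.Perm (Fin t)) :
    permGram t D (σ * g) (τ * g) = permGram t D σ τ := by
  simp only [permGram, of_apply]
  congr 2
  group

/-- The spectrum is finite, so inversion is continuous on it, and `x * x⁻¹ * x = x` holds even at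
`0`. This is the only Moore–Penrose identity the expansion needs. -/
theorem permGram_mul_weingartenMatrix_mul (t D : ℕ) :
    permGram t D * weingartenMatrix t D * permGram t D = permGram t D := by
  have hG := permGram_isSelfAdjoint t D
  have hfin : ∀ f : ℝ → ℝ, ContinuousOn f (spectrum ℝ (permGram t D)) := fun f =>
    (Matrix.finite_real_spectrum (A := permGram t D)).continuousOn f
  have hid : cfc (fun x : ℝ => x) (permGram t D) = permGram t D := cfc_id' ℝ _ hG
  have h : cfc (fun x : ℝ => x * x⁻¹ * x) (permGram t D) =
      permGram t D * weingartenMatrix t D * permGram t D := by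
    rw [cfc_mul _ _ _ (hfin _) (hfin _), cfc_mul _ _ _ (hfin _) (hfin _), hid, weingartenMatrix]
  rw [← h]
  simp only [mul_inv_mul_cancel]
  exact hid

theorem weingartenMatrix_comm {t D : ℕ} (σ τ : Equiv.Perm (Fin t)) :
    weingartenMatrix t D σ τ = weingartenMatrix t D τ σ := by
  have h : IsSelfAdjoint (weingartenMatrix t D) := cfc_predicate _ _
  have := congrFun (congrFun h.star_eq τ) σ
  simpa [Matrix.star_apply] using this

/-- Right translation by `g` commutes with the Gram matrix, hence with its functional calculus. The
entries therefore depend only on `σ * τ⁻¹`. -/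
theorem weingartenMatrix_mul_right {t D : ℕ} (σ τ g : Equiv.Perm (Fin t)) :
    weingartenMatrix t D (σ * g) (τ * g) = weingartenMatrix t D σ τ := by
  let R : Matrix (Equiv.Perm (Fin t)) (Equiv.Perm (Fin t)) ℝ :=
    Matrix.of fun σ τ => if σ * g = τ then 1 else 0
  have hl : ∀ (M : Matrix (Equiv.Perm (Fin t)) (Equiv.Perm (Fin t)) ℝ) σ τ,
      (R * M) σ τ = M (σ * g) τ := by
    simp [R, Matrix.mul_apply]
  have hr : ∀ (M : Matrix (Equiv.Perm (Fin t)) (Equiv.Perm (Fin t)) ℝ) σ τ,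
      (M * R) σ (τ * g) = M σ τ := by
    simp [R, Matrix.mul_apply]
  have hcomm : Commute (permGram t D) R := by
    ext σ τ
    obtain ⟨τ, rfl⟩ : ∃ τ', τ' * g = τ := ⟨τ * g⁻¹, by group⟩
    rw [hl, hr, permGram_mul_right]
  have h : Commute (weingartenMatrix t D) R :=
    (permGram_isSelfAdjoint t D).commute_cfc hcomm _
  have := congrFun (congrFun h.eq σ) (τ * g)
  rwa [hl, hr, eq_comm] at this

theorem weingarten_mul_inv {t D : ℕ} (σ τ : Equiv.Perm (Fin t)) :
    weingarten (σ * τ⁻¹) D = weingartenMatrix t D τ σ := by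
  rw [weingarten, ← weingartenMatrix_mul_right _ _ τ, inv_mul_cancel_right, one_mul,
    weingartenMatrix_comm]

/-! ### Expansion in permutation operators -/

section Span

variable {n : Type} [Fintype n] [DecidableEq n] {t : ℕ}

/-- The overlap counts the index tuples fixed by `σ * τ⁻¹`, that is, those constant on its cycles.
-/
theorem sum_permMatrixHom_mul (σ τ : Equiv.Perm (Fin t)) :
    ∑ x, ∑ y, permMatrixHom n t σ x y * permMatrixHom n t τ x y =
      (permGram t (Fintype.card n) σ τ : ℂ) := by
  have h : ∀ x : Fin t → n, x ∘ τ = x ∘ σ ↔ x ∘ ⇑(σ * τ⁻¹) = x := by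
    intro x
    constructor
    · intro h
      rw [Equiv.Perm.coe_mul, ← Function.comp_assoc, ← h]
      ext
      simp
    · intro h
      conv_lhs => rw [← h]
      ext
      simp
  simp only [permMatrixHom_apply, ite_mul, one_mul, zero_mul, Finset.sum_ite_eq, Finset.mem_univ,
    if_true, h]
  rw [Finset.sum_boole, ← Fintype.card_subtype, card_comp_eq_self]
  simp [permGram]

open scoped ComplexOrder in
/-- An element of the span of the permutation matrices is recovered from its overlaps with
them through the pseudo-inverse of the Gram matrix. -/
theorem eq_sum_weingartenMatrix_of_mem_span {T : Matrix (Fin t → n) (Fin t → n) ℂ}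
    (hT : T ∈ Submodule.span ℂ (Set.range (permMatrixHom n t))) :
    T = ∑ τ, (∑ σ, (weingartenMatrix t (Fintype.card n) τ σ : ℂ) *
      ∑ x, ∑ y, permMatrixHom n t σ x y * T x y) • permMatrixHom n t τ := by
  obtain ⟨c, rfl⟩ := (Submodule.mem_span_range_iff_exists_fun ℂ).1 hT
  set G := (permGram t (Fintype.card n)).map ((↑) : ℝ → ℂ) with hG
  set M := (weingartenMatrix t (Fintype.card n)).map ((↑) : ℝ → ℂ) with hM
  have hGMG : G * M * G = G := by
    have := congrArg (fun A => A.map Complex.ofRealHom)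
      (permGram_mul_weingartenMatrix_mul t (Fintype.card n))
    simp only [Matrix.map_mul] at this
    exact this
  have hpair : ∀ (c : Equiv.Perm (Fin t) → ℂ) σ,
      ∑ x, ∑ y, permMatrixHom n t σ x y * (∑ τ, c τ • permMatrixHom n t τ) x y = (G *ᵥ c) σ := by
    intro c σ
    simp only [Matrix.sum_apply, Matrix.smul_apply, smul_eq_mul, Finset.mul_sum, mulVec,
      dotProduct, hG, map_apply, ← sum_permMatrixHom_mul, Finset.sum_mul]
    rw [Finset.sum_congr rfl fun x _ => Finset.sum_comm, Finset.sum_comm]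
    exact Finset.sum_congr rfl fun _ _ => Finset.sum_congr rfl fun _ _ =>
      Finset.sum_congr rfl fun _ _ => by ring
  -- The permutation operators may be linearly dependent, so coefficients are not unique. But a
  -- vector `e` in the kernel of `G` gives the zero operator, since its squared Hilbert–Schmidt norm
  -- is `e* G e = 0`.
  have hker : ∀ e : Equiv.Perm (Fin t) → ℂ, G *ᵥ e = 0 → ∑ τ, e τ • permMatrixHom n t τ = 0 := by
    intro e he
    set S := ∑ τ, e τ • permMatrixHom n t τ with hS
    have hnorm : ∑ x, ∑ y, star (S x y) * S x y = 0 := by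
      have h1 : ∀ x y, star (S x y) = ∑ τ, star (e τ) * permMatrixHom n t τ x y := by
        intro x y
        simp [hS, Matrix.sum_apply, permMatrixHom_apply, apply_ite]
      calc ∑ x, ∑ y, star (S x y) * S x y
          = ∑ τ, star (e τ) * ∑ x, ∑ y, permMatrixHom n t τ x y * S x y := by
            simp only [h1, Finset.sum_mul, Finset.mul_sum]
            rw [Finset.sum_congr rfl fun x _ => Finset.sum_comm, Finset.sum_comm]
            simp only [mul_assoc]
        _ = 0 := by simp [hpair, he, hS]
    have h : trace (Sᴴ * S) = 0 := by
      rw [← hnorm, Finset.sum_comm]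
      simp [trace, Matrix.mul_apply]
    exact trace_conjTranspose_mul_self_eq_zero_iff.1 h
  -- By `G M G = G`, the coefficients `c` and `M G c` differ by a kernel vector.
  have hzero := hker (c - M *ᵥ (G *ᵥ c)) (by
    rw [mulVec_sub, mulVec_mulVec, mulVec_mulVec, hGMG, sub_self])
  simp only [Pi.sub_apply, sub_smul, Finset.sum_sub_distrib, sub_eq_zero] at hzero
  simp only [hpair]
  exact hzero

end Span

/-! ### Haar moments of the unitary group -/

section Integral

variable {n : Type} [Fintype n] [DecidableEq n] {t : ℕ}

instance instIsProbabilityMeasureHaarUnitary :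
    MeasureTheory.IsProbabilityMeasure (haarUnitary n) :=
  ⟨MeasureTheory.Measure.haarMeasure_self⟩

instance instIsMulLeftInvariantHaarUnitary :
    (haarUnitary n).IsMulLeftInvariant :=
  inferInstanceAs (MeasureTheory.Measure.haarMeasure _).IsMulLeftInvariant

theorem integrable_haarUnitary {f : unitaryGroup n ℂ → ℂ} (hf : Continuous f) :
    MeasureTheory.Integrable f (haarUnitary n) :=
  hf.integrable_of_hasCompactSupport (HasCompactSupport.of_compactSpace f)

theorem continuous_unitaryGroup_apply (x y : n) :
    Continuous fun U : unitaryGroup n ℂ => (U : Matrix n n ℂ) x y :=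
  (continuous_apply_apply x y).comp continuous_subtype_val

/-- The Haar moment of entries `U_{y,q}` and conjugate entries `U_{x,p}`. -/
noncomputable def haarMoment (p q : Fin t → n) : Matrix (Fin t → n) (Fin t → n) ℂ :=
  Matrix.of fun x y => ∫ U : unitaryGroup n ℂ,
    ∏ s, star ((U : Matrix n n ℂ) (x s) (p s)) * (U : Matrix n n ℂ) (y s) (q s) ∂haarUnitary n

theorem continuous_moment (p q x y : Fin t → n) : Continuous fun U : unitaryGroup n ℂ =>
    ∏ s, star ((U : Matrix n n ℂ) (x s) (p s)) * (U : Matrix n n ℂ) (y s) (q s) :=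
  continuous_finsetProd _ fun _ _ =>
    (continuous_star.comp (continuous_unitaryGroup_apply _ _)).mul
      (continuous_unitaryGroup_apply _ _)

/-- Substituting `V * U` for `U` in the integral mixes the row indices only; the columns `p` and `q`
stay fixed. -/
theorem haarMoment_eq_conj (p q : Fin t → n) (V : unitaryGroup n ℂ) :
    haarMoment p q = tensorPowMatrix t ((V : Matrix n n ℂ).map star) * haarMoment p q *
      tensorPowMatrix t (V : Matrix n n ℂ)ᵀ := by
  ext x y
  simp only [Matrix.mul_apply, haarMoment, of_apply, Finset.sum_mul]
  rw [← MeasureTheory.integral_mul_left_eq_self _ V]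
  simp_rw [← MeasureTheory.integral_const_mul, ← MeasureTheory.integral_mul_const]
  have hint : ∀ y' x' : Fin t → n, MeasureTheory.Integrable (fun U : unitaryGroup n ℂ =>
      (tensorPowMatrix t ((V : Matrix n n ℂ).map star) x x' *
        ∏ s, star ((U : Matrix n n ℂ) (x' s) (p s)) * (U : Matrix n n ℂ) (y' s) (q s)) *
          tensorPowMatrix t (V : Matrix n n ℂ)ᵀ y' y) (haarUnitary n) := fun y' x' =>
    integrable_haarUnitary ((continuous_const.mul (continuous_moment p q x' y')).mul
      continuous_const)
  refine Eq.trans ?_ ((MeasureTheory.integral_finsetSum _ fun y' _ =>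
    MeasureTheory.integrable_finsetSum _ fun x' _ => hint y' x').trans
      (Finset.sum_congr rfl fun y' _ =>
        MeasureTheory.integral_finsetSum _ fun x' _ => hint y' x'))
  congr 1
  funext U
  simp only [Submonoid.coe_mul, Matrix.mul_apply, star_sum, star_mul', Finset.prod_mul_distrib,
    Fintype.prod_sum, tensorPowMatrix_apply, map_apply, transpose_apply, Finset.sum_mul_sum]
  rw [Finset.sum_comm]
  exact Finset.sum_congr rfl fun _ _ => Finset.sum_congr rfl fun _ _ => by ring

theorem haarMoment_mem_span (p q : Fin t → n) :
    haarMoment p q ∈ Submodule.span ℂ (Set.range (permMatrixHom n t)) := by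
  refine mem_span_permMatrixHom_of_commute fun U hU => ?_
  have hV : U.map star ∈ unitaryGroup n ℂ := by
    rw [mem_unitaryGroup_iff] at hU ⊢
    have h : star (U.map star) = (star U).map star := by
      ext
      simp [Matrix.star_apply]
    have := congrArg (fun A => A.map (starRingEnd ℂ)) hU
    simp only [Matrix.map_mul] at this
    rw [h]
    exact this.trans (Matrix.map_one _ (map_zero _) (map_one _))
  -- The invariance involves the entrywise conjugate of `V`, so it is applied to the conjugate of
  -- `U`.
  have h := haarMoment_eq_conj p q ⟨_, hV⟩
  have h1 : ((U.map star).map star) = U := by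
    ext
    simp
  have h2 : (U.map star)ᵀ * U = 1 := mem_unitaryGroup_iff'.1 hU
  simp only [h1] at h
  rw [commute_iff_eq]
  conv_lhs => rw [h]
  rw [mul_assoc, ← tensorPowMatrix_mul, h2, tensorPowMatrix_one, mul_one]

/-- Orthonormality of the columns makes the summed integrand independent of `U`, and the measure has
total mass one. -/
theorem sum_permMatrixHom_mul_haarMoment (p q : Fin t → n) (σ : Equiv.Perm (Fin t)) :
    ∑ x, ∑ y, permMatrixHom n t σ x y * haarMoment p q x y = if q = p ∘ σ then 1 else 0 := by
  simp only [permMatrixHom_apply, ite_mul, one_mul, zero_mul, Finset.sum_ite_eq, Finset.mem_univ,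
    if_true, haarMoment, of_apply]
  rw [← MeasureTheory.integral_finsetSum _ fun x _ =>
    integrable_haarUnitary (continuous_moment p q x (x ∘ σ))]
  have h : ∀ U : unitaryGroup n ℂ, ∑ x : Fin t → n,
      ∏ s, star ((U : Matrix n n ℂ) (x s) (p s)) * (U : Matrix n n ℂ) ((x ∘ σ) s) (q s) =
        if q = p ∘ σ then 1 else 0 := by
    intro U
    have hU : star (U : Matrix n n ℂ) * U = 1 := mem_unitaryGroup_iff'.1 U.2
    calc _ = ∑ x : Fin t → n, ∏ s, star ((U : Matrix n n ℂ) (x s) (p s)) *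
          (U : Matrix n n ℂ) (x s) (q (σ⁻¹ s)) := by
          refine Finset.sum_congr rfl fun x _ => ?_
          rw [Finset.prod_mul_distrib, Finset.prod_mul_distrib]
          congr 1
          rw [← Equiv.prod_comp σ fun s => (U : Matrix n n ℂ) (x s) (q (σ⁻¹ s))]
          simp
      _ = ∏ s, (star (U : Matrix n n ℂ) * U) (p s) (q (σ⁻¹ s)) := by
          simp only [Matrix.mul_apply, Fintype.prod_sum, Matrix.star_apply]
      _ = _ := by
          simp only [hU, Matrix.one_apply, Finset.prod_ite_zero, Finset.mem_univ, true_implies,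
            Finset.prod_const_one]
          refine if_congr ⟨fun h => ?_, ?_⟩ rfl rfl
          · funext s
            simp [h]
          · rintro rfl
            simp
  simp only [h, MeasureTheory.integral_const, MeasureTheory.probReal_univ, one_smul]

/-- The Weingarten formula for the moments of the Haar measure on the unitary group. -/
theorem haarMoment_apply (p q x y : Fin t → n) :
    haarMoment p q x y = ∑ σ : Equiv.Perm (Fin t), ∑ τ : Equiv.Perm (Fin t),
      (weingarten (σ * τ⁻¹) (Fintype.card n) : ℂ) *
        ((if q = p ∘ σ then 1 else 0) * (if y = x ∘ τ then 1 else 0)) := by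
  conv_lhs => rw [eq_sum_weingartenMatrix_of_mem_span (haarMoment_mem_span p q)]
  simp only [sum_permMatrixHom_mul_haarMoment]
  simp only [Matrix.sum_apply, Matrix.smul_apply, smul_eq_mul,
    Finset.sum_mul, permMatrixHom_apply, weingarten_mul_inv]
  rw [Finset.sum_comm]
  refine Finset.sum_congr rfl fun σ _ => Finset.sum_congr rfl fun τ _ => ?_
  rw [mul_assoc]
  simp only [eq_comm]

end Integral

/-! ### Choi states determine their maps -/

theorem choi_apply {n : Type} [Fintype n] [DecidableEq n]
    (Ψ : Matrix n n ℂ →ₗ[ℂ] Matrix n n ℂ) (i a j b : n) :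
    choi Ψ (i, a) (j, b) = (Fintype.card n : ℂ)⁻¹ * Ψ (single a b 1) i j := by
  have h : (Matrix.of fun i j => vecMulVec (maxEntangled n) (star (maxEntangled n)) (i, a) (j, b)) =
      (Fintype.card n : ℂ)⁻¹ • single a b (1 : ℂ) := by
    have hsq : ((Real.sqrt (Fintype.card n) : ℝ) : ℂ)⁻¹ * ((Real.sqrt (Fintype.card n) : ℝ) : ℂ)⁻¹ =
        (Fintype.card n : ℂ)⁻¹ := by
      rw [← mul_inv, ← Complex.ofReal_mul, Real.mul_self_sqrt (by positivity)]
      simp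
    ext i j
    by_cases hi : i = a <;> by_cases hj : j = b <;>
      simp [vecMulVec_apply, maxEntangled, hi, hj, hsq, eq_comm (a := a),
        eq_comm (a := b)]
  simp only [choi, extendMap, of_apply]
  rw [h, map_smul, Matrix.smul_apply, smul_eq_mul]

/-- Up to a nonzero factor, the entries of the Choi state are those of the images of the matrix
units. -/
theorem choi_eq_iff {n : Type} [Fintype n] [DecidableEq n] [Nonempty n]
    {Ψ Ψ' : Matrix n n ℂ →ₗ[ℂ] Matrix n n ℂ} : choi Ψ = choi Ψ' ↔ Ψ = Ψ' := by
  refine ⟨fun h => ?_, fun h => h ▸ rfl⟩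
  refine Matrix.ext_linearMap ℂ fun a b => LinearMap.ext_ring ?_
  ext i j
  have := congrFun (congrFun h (i, a)) (j, b)
  rw [choi_apply, choi_apply] at this
  exact mul_left_cancel₀ (inv_ne_zero (by exact_mod_cast Fintype.card_ne_zero)) this

/-! ### The Haar-averaged channel and the design criterion -/

variable {d k t : ℕ} [NeZero k]

/-- The form matches the integrand of `haarMoment`: the initial state `|0⟩` fixes the environment
part of the columns, and the partial trace puts the same `l` in both rows. -/
theorem dilation_apply (U : Matrix (Fin d × Fin k) (Fin d × Fin k) ℂ)
    (ρ : Matrix (Fin t → Fin d) (Fin t → Fin d) ℂ) (i j : Fin t → Fin d) :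
    dilation t U ρ i j = ∑ a, ∑ b, ρ a b * ∑ l : Fin t → Fin k,
      ∏ s, star (U (j s, l s) (b s, 0)) * U (i s, l s) (a s, 0) := by
  have hz : ∀ l m : Fin t → Fin k, tensorPowMatrix t (single (0 : Fin k) 0 (1 : ℂ)) l m =
      if l = 0 ∧ m = 0 then 1 else 0 := by
    intro l m
    simp only [tensorPowMatrix_apply, single_apply, Finset.prod_ite_zero, Finset.mem_univ,
      true_implies, Finset.prod_const_one, funext_iff, forall_and, eq_comm, Pi.zero_apply]
  simp only [dilation, LinearMap.coe_mk, AddHom.coe_mk, traceEnv, of_apply, Matrix.mul_apply,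
    kroneckerMap_apply, Fintype.sum_prod_type, hz]
  simp only [ite_and, mul_ite, mul_one, mul_zero, ite_mul, zero_mul, Finset.sum_ite_eq',
    Finset.sum_ite_irrel, Finset.sum_const_zero, Finset.mem_univ, if_true]
  simp only [tensorPowSplit, reindex_apply, submatrix_apply, tensorPowMatrix_apply,
    conjTranspose_apply, Finset.sum_mul, Finset.mul_sum, Finset.prod_mul_distrib]
  rw [Finset.sum_comm, Finset.sum_congr rfl fun b _ => Finset.sum_comm, Finset.sum_comm]
  refine Finset.sum_congr rfl fun a _ => Finset.sum_congr rfl fun b _ =>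
    Finset.sum_congr rfl fun l _ => ?_
  simp only [Equiv.arrowProdEquivProdArrow, Equiv.coe_fn_symm_mk, Pi.zero_apply]
  ring

theorem integrable_dilation (ρ : Matrix (Fin t → Fin d) (Fin t → Fin d) ℂ)
    (i j : Fin t → Fin d) :
    MeasureTheory.Integrable (fun U : unitaryGroup (Fin d × Fin k) ℂ =>
      dilation t (U : Matrix (Fin d × Fin k) (Fin d × Fin k) ℂ) ρ i j)
      (haarUnitary (Fin d × Fin k)) := by
  simp only [dilation_apply]
  refine integrable_haarUnitary (continuous_finsetSum _ fun a _ => continuous_finsetSum _ fun b _ =>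
    continuous_const.mul (continuous_finsetSum _ fun l _ => ?_))
  exact continuous_moment (fun s => (b s, 0)) (fun s => (a s, 0)) (fun s => (j s, l s))
    fun s => (i s, l s)

/-- The Haar average of the dilated channels. -/
noncomputable def haarChannel (d k t : ℕ) [NeZero k] :
    Matrix (Fin t → Fin d) (Fin t → Fin d) ℂ →ₗ[ℂ] Matrix (Fin t → Fin d) (Fin t → Fin d) ℂ where
  toFun ρ := Matrix.of fun x y => ∫ U : unitaryGroup (Fin d × Fin k) ℂ,
    dilation t (U : Matrix (Fin d × Fin k) (Fin d × Fin k) ℂ) ρ x y ∂(haarUnitary (Fin d × Fin k))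
  map_add' ρ ρ' := by
    ext x y
    simp only [map_add, Matrix.add_apply, of_apply]
    exact MeasureTheory.integral_add (integrable_dilation ρ x y) (integrable_dilation ρ' x y)
  map_smul' c ρ := by
    ext x y
    simp only [map_smul, Matrix.smul_apply, of_apply, smul_eq_mul, RingHom.id_apply]
    exact MeasureTheory.integral_const_mul c _

theorem haarChoi_eq_choi : haarChoi d k t = choi (haarChannel d k t) := by
  ext ⟨i, a⟩ ⟨j, b⟩
  simp only [haarChoi, of_apply, choi_apply, haarChannel, LinearMap.coe_mk, AddHom.coe_mk]
  exact MeasureTheory.integral_const_mul _ _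

theorem haarChannel_single (a b i j : Fin t → Fin d) :
    haarChannel d k t (single a b 1) i j = ∑ l : Fin t → Fin k,
      haarMoment (fun s => ((b s, 0) : Fin d × Fin k)) (fun s => (a s, 0))
        (fun s => (j s, l s)) (fun s => (i s, l s)) := by
  simp only [haarChannel, LinearMap.coe_mk, AddHom.coe_mk, of_apply, haarMoment]
  refine Eq.trans ?_ (MeasureTheory.integral_finsetSum _ fun l _ => integrable_haarUnitary
    (continuous_moment (fun s => ((b s, 0) : Fin d × Fin k)) (fun s => (a s, 0))
      (fun s => (j s, l s)) (fun s => (i s, l s))))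
  congr 1
  funext U
  simp [dilation_apply, single_apply, ite_and]

theorem haarChoi_apply (a b i j : Fin t → Fin d) :
    haarChoi d k t (i, a) (j, b) =
      ((d : ℂ) ^ t)⁻¹ * ∑ σ : Equiv.Perm (Fin t), ∑ τ : Equiv.Perm (Fin t),
        (weingarten (σ * τ⁻¹) (d * k) : ℂ) * (k : ℂ) ^ numCycles τ *
          ∏ n : Fin t, (if a n = b (σ n) then (1 : ℂ) else 0) *
            (if i n = j (τ n) then (1 : ℂ) else 0) := by
  -- The power of `k` is traded for a sum over environment indices, so that both sides can be
  -- compared term by term in `l`.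
  have hcard : ∀ τ : Equiv.Perm (Fin t), (k : ℂ) ^ numCycles τ =
      ∑ l : Fin t → Fin k, if l = l ∘ τ then 1 else 0 := by
    intro τ
    have := card_comp_eq_self (n := Fin k) τ
    rw [Fintype.card_subtype, Fintype.card_fin] at this
    rw [Finset.sum_boole, ← Nat.cast_pow, ← this]
    simp only [eq_comm]
  rw [haarChoi_eq_choi, choi_apply, haarChannel_single]
  simp only [haarMoment_apply, Fintype.card_fun, Fintype.card_fin, Fintype.card_prod, Nat.cast_pow]
  congr 1
  rw [Finset.sum_comm]
  refine Finset.sum_congr rfl fun σ _ => ?_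
  rw [Finset.sum_comm]
  refine Finset.sum_congr rfl fun τ _ => ?_
  rw [hcard, ← Finset.mul_sum, mul_assoc, Finset.sum_mul]
  congr 1
  refine Finset.sum_congr rfl fun l _ => ?_
  simp only [Finset.prod_mul_distrib, Finset.prod_ite_zero, Finset.mem_univ, true_implies,
    Finset.prod_const_one, funext_iff, Function.comp_apply, Prod.mk.injEq, and_true, forall_and]
  simp only [ite_and, mul_ite, mul_one, mul_zero]
  split_ifs <;> simp_all

theorem averageChoi_eq_choi {m : ℕ} (Φ : Fin m → Channel d) :
    averageChoi t Φ = choi ((m : ℂ)⁻¹ • ∑ i, tensorPowMap t (Φ i).lin) := by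
  ext ⟨i, a⟩ ⟨j, b⟩
  simp only [averageChoi, Matrix.smul_apply, Matrix.sum_apply, choi_apply, LinearMap.smul_apply,
    LinearMap.sum_apply, smul_eq_mul, ← Finset.mul_sum]
  ring

/-- Both sides are Choi states of linear maps, and the design condition is the equality of those
maps at every `ρ`. -/
theorem averageChoi_eq_haarChoi_iff [NeZero d] {m : ℕ} (Φ : Fin m → Channel d) :
    averageChoi t Φ = haarChoi d k t ↔ IsChannelDesign t k Φ := by
  rw [averageChoi_eq_choi, haarChoi_eq_choi, choi_eq_iff, LinearMap.ext_iff, IsChannelDesign]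
  refine forall_congr' fun ρ => ?_
  rw [LinearMap.smul_apply, LinearMap.sum_apply]
  rfl

end ChannelDesign

theorem mainTheorem1 (d k t : ℕ) [NeZero d] [NeZero k] (_ht : 1 ≤ t) :
    (∀ a b i j : Fin t → Fin d,
      ChannelDesign.haarChoi d k t (i, a) (j, b) =
        ((d : ℂ) ^ t)⁻¹ * ∑ σ : Equiv.Perm (Fin t), ∑ τ : Equiv.Perm (Fin t),
          (ChannelDesign.weingarten (σ * τ⁻¹) (d * k) : ℂ) *
            (k : ℂ) ^ ChannelDesign.numCycles τ *
            ∏ n : Fin t, (if a n = b (σ n) then (1 : ℂ) else 0) *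
              (if i n = j (τ n) then (1 : ℂ) else 0)) ∧
    ∀ (m : ℕ) (_hm : 1 ≤ m) (Φ : Fin m → ChannelDesign.Channel d)
      (N : Seminorm ℂ (Matrix ((Fin t → Fin d) × (Fin t → Fin d))
        ((Fin t → Fin d) × (Fin t → Fin d)) ℂ))
      (_hN : ∀ A, N A = 0 → A = 0),
      0 ≤ N (ChannelDesign.averageChoi t Φ - ChannelDesign.haarChoi d k t) ∧
        (N (ChannelDesign.averageChoi t Φ - ChannelDesign.haarChoi d k t) = 0 ↔
          ChannelDesign.IsChannelDesign t k Φ) := by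
  refine ⟨ChannelDesign.haarChoi_apply, fun m _ Φ N hN => ⟨apply_nonneg N _, ?_⟩⟩
  rw [← ChannelDesign.averageChoi_eq_haarChoi_iff, ← sub_eq_zero (b := ChannelDesign.haarChoi d k t)]
  exact ⟨hN _, fun h => by rw [h, map_zero]⟩
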